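/- Let $\Gamma=(V,E,w)$ be a directed network: a directed graph, possibly infinite, with loops and multiple edges allowed, with a weight $w(e)$ on each edge, and with a distinguished set $\partial\Gamma\subset V$ of boundary vertices; the vertices in $V\setminus\partial\Gamma$ are called interior. The weight of a walk is the product of the weights of its edges. An interior walk from $a$ to $b$ is a walk $a=v_0\to v_1\to\cdots\to v_m=b$ of nonzero length $m$ with $v_1,\dots,v_{m-1}\notin\partial\Gamma$. For $a\in V$ and $b\in\partial\Gamma$ let $X(a,b)=\sum_\pi w(\pi)$, the sum over all interior walks $\pi$ from $a$ to $b$. The loop-erased part $\mathrm{LE}(\pi)$ of a walk is obtained by erasing its loops in the order in which they arise; for an interior walk that returns to the boundary vertex from which it started, the initial and the terminal point are regarded as different, so that the whole walk does not count as a loop (only loops at interior vertices are erased). Let $a_1,\dots,a_k\in V$ and $b_1,\dots,b_k\in\partial\Gamma$, and let $X_{A,B}=(X(a_i,b_j))_{i,j=1}^k$. Assume that for all $i<i'$ and $j'<j$, every interior walk from $a_i$ to $b_j$ and every interior walk from $a_{i'}$ to $b_{j'}$ have a common vertex in $V\setminus\partial\Gamma$ (end points of the walks included). Then $$\det(X_{A,B})=\sum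 w(\pi_1)\cdots w(\pi_k),$$ where the sum runs over all families in which each $\pi_i$ is an interior walk from $a_i$ to $b_i$ and, for each $1\le i<k$, the walk $\pi_{i+1}$ has no common vertices with $\mathrm{LE}(\pi_i)$ in $V\setminus\partial\Gamma$. The identity holds in the ring of formal power series over $\mathbb Z$ when the $w(e)$ are independent variables (the sums defining the entries and the sum above then converge coefficientwise), and it holds in $\mathbb R$ when the $w(e)$ are real numbers for which the series $X(a_i,b_j)$, $1\le i,j\le k$, converge absolutely (the sum above then converges absolutely as well). In particular, if the edge weights are nonnegative real numbers for which the series $X(a_i,b_j)$, $1\le i,j\le k$, converge, then the matrix $X_{A,B}$ is totally nonnegative, i.e. all its minors are nonnegative. -/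

import Mathlib

open scoped MvPowerSeries.WithPiTopology

/-!
A directed network is a quiver `V` (loops and multiple edges are allowed, no finiteness is imposed);
its edge set is `Quiver.Total V`, its walks are `Quiver.Path a b`, and the weight of a walk is the
product of the weights of its edges (`Quiver.Path.weight`).
-/

namespace Quiver.Path

variable {V : Type*} [Quiver V]

open Classical in
/-- The initial segment of a walk up to its first visit to `v`. -/
noncomputable def takeUntil {a : V} :
    ∀ {b : V} (p : Path a b) (v : V), v ∈ p.vertices → Path a v
  | _, nil, v, hv => by
      have h : v = a := by simpa using hv
      rw [h]
      exact nil
  | _, cons p e, v, hv =>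
      if h : v ∈ p.vertices then takeUntil p v h
      else by
        have h' := ((mem_vertices_cons p e).1 hv).resolve_left h
        rw [h']
        exact p.cons e

open Classical in
/-- The loop-erased part of a walk: loops are erased in the order in which the walk makes them.
When the next step arrives at a vertex of the current loop-erased walk, the loop just closed is
removed; otherwise the step is appended. -/
noncomputable def loopErasure {a : V} : ∀ {b : V}, Path a b → Path a b
  | _, nil => nil
  | _, cons (c := c) p e =>
      if h : c ∈ (loopErasure p).vertices then takeUntil (loopErasure p) c h
      else (loopErasure p).cons e

/-- The loop-erased part of a walk whose terminal point counts as different from all earlier points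
of the walk: the loops of the walk without its last step are erased, and the last step is kept.
For a walk through the interior that ends on the boundary this is the usual loop-erased part, except
when the walk returns to the boundary vertex it started from
(see `loopErasureKeepLast_eq_loopErasure`). -/
noncomputable def loopErasureKeepLast {a : V} : ∀ {b : V}, Path a b → Path a b
  | _, nil => nil
  | _, cons p e => (loopErasure p).cons e

/-- Every vertex of an initial segment is a vertex of the walk. -/
theorem vertices_takeUntil_subset {a : V} : ∀ {b : V} (p : Path a b) (v : V) (hv : v ∈ p.vertices),
    (p.takeUntil v hv).vertices ⊆ p.vertices
  | _, nil, v, hv => by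
      have h : v = a := by simpa using hv
      subst h
      simp [takeUntil]
  | _, cons p e, v, hv => by
      intro x hx
      rw [takeUntil] at hx
      split_ifs at hx with h
      · exact (mem_vertices_cons p e).2 (Or.inl (vertices_takeUntil_subset p v h hx))
      · have h' := ((mem_vertices_cons p e).1 hv).resolve_left h
        subst h'
        exact hx

/-- Every vertex of the loop-erased part is a vertex of the walk. -/
theorem vertices_loopErasure_subset {a : V} : ∀ {b : V} (p : Path a b),
    p.loopErasure.vertices ⊆ p.vertices
  | _, nil => by simp [loopErasure]
  | _, cons p e => by
      intro x hx
      rw [loopErasure] at hx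
      split_ifs at hx with h
      · exact (mem_vertices_cons p e).2
          (Or.inl (vertices_loopErasure_subset p (vertices_takeUntil_subset _ _ h hx)))
      · rcases (mem_vertices_cons _ e).1 hx with hx | hx
        · exact (mem_vertices_cons p e).2 (Or.inl (vertices_loopErasure_subset p hx))
        · exact (mem_vertices_cons p e).2 (Or.inr hx)

/-- A walk without self-intersections is its own loop-erased part. -/
theorem loopErasure_of_nodup {a : V} : ∀ {b : V} (p : Path a b), p.vertices.Nodup →
    p.loopErasure = p
  | _, nil, _ => rfl
  | _, cons p e, h => by
      rw [vertices_cons, List.concat_eq_append, List.nodup_append] at h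
      rw [loopErasure, loopErasure_of_nodup p h.1, dif_neg]
      intro hc
      exact h.2.2 _ hc _ (by simp) rfl

theorem loopErasure_comp_congr {a b c : V} (p p' : Path a b) (h : p.loopErasure = p'.loopErasure)
    (q : Path b c) : (p.comp q).loopErasure = (p'.comp q).loopErasure := by
  induction q with
  | nil => simpa
  | cons q e ih =>
    simp only [comp_cons]
    rw [loopErasure, loopErasure]
    generalize (p.comp q).loopErasure = x at ih ⊢
    subst ih
    rfl

theorem takeUntil_comp {a b : V} (p : Path a b) : ∀ {c : V} (l : Path b c)
    (h : ∀ v ∈ p.vertices.dropLast, v ≠ b) (hb : b ∈ (p.comp l).vertices),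
    (p.comp l).takeUntil b hb = p
  | _, nil, _h, hb => by
      cases p with
      | nil => simp [takeUntil]
      | cons q e =>
        simp only [comp_nil]
        rw [takeUntil, dif_neg]
        · rfl
        · intro hb; exact _h b (by simpa using hb) rfl
  | _, cons l e, h, hb => by
      simp only [comp_cons]
      have : b ∈ (p.comp l).vertices := by simp [start_mem_vertices]
      rw [takeUntil, dif_pos this, takeUntil_comp p l h]

/-- Removing the first loop `l` that a walk makes does not change its loop-erased part; together with
`loopErasure_of_nodup` this is the usual recursive description of loop erasure. -/
theorem loopErasure_comp_loop_comp {a b c : V} (p : Path a b) (l : Path b b) (q : Path b c)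
    (hl : 0 < l.length) (h : (p.comp l).vertices.dropLast.Nodup) :
    ((p.comp l).comp q).loopErasure = (p.comp q).loopErasure := by
  apply loopErasure_comp_congr
  obtain ⟨d, l, e, rfl⟩ := (length_ne_zero_iff_eq_cons l).mp hl.ne'
  simp only [comp_cons, vertices_cons, List.concat_eq_append, List.dropLast_concat] at h
  have hp : ∀ v ∈ p.vertices.dropLast, v ≠ b := by
    rintro v hv rfl
    rw [vertices_comp, List.nodup_append] at h
    exact h.2.2 _ hv _ (start_mem_vertices l) rfl
  have hpn : p.vertices.Nodup := by
    rw [vertices_comp] at h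
    rw [← dropLast_append_end_eq, List.nodup_append]
    rw [List.nodup_append] at h
    exact ⟨h.1, by simp, fun x hx y hy => by simp at hy; subst hy; exact hp x hx⟩
  have hb : b ∈ (p.comp l).vertices := by simp [start_mem_vertices]
  simp only [comp_cons]
  rw [loopErasure, loopErasure_of_nodup _ hpn]
  have hx := loopErasure_of_nodup _ h
  generalize (p.comp l).loopErasure = x at hx ⊢
  subst hx
  rw [dif_pos hb, takeUntil_comp p l hp]

end Quiver.Path

open Quiver

/-- The walks from `a` to `b` of nonzero length whose internal vertices all lie outside the boundary
`bd`. -/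
def InteriorWalk {V : Type*} [Quiver V] (bd : Set V) (a b : V) : Type _ :=
  {p : Path a b // 0 < p.length ∧ ∀ v ∈ p.vertices.tail.dropLast, v ∉ bd}

namespace InteriorWalk

variable {V : Type*} [Quiver V] {bd : Set V} {a b : V}

/-- All vertices of an interior walk, including both end points. -/
def vertices (p : InteriorWalk bd a b) : List V := p.1.vertices

/-- The vertices of the loop-erased part of an interior walk, where the terminal point counts as
different from the initial point. -/
noncomputable def loopErasedVertices (p : InteriorWalk bd a b) : List V :=
  p.1.loopErasureKeepLast.vertices

/-- The weight of an interior walk is the product of the weights of its edges. -/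
def weight {R : Type*} [CommSemiring R] (w : Total V → R) (p : InteriorWalk bd a b) : R :=
  p.1.weight (fun {c d} (e : c ⟶ d) => w ⟨c, d, e⟩)

/-- For an interior walk ending on the boundary at a vertex other than its starting point, keeping
the last step makes no difference: this is the usual loop-erased part. -/
theorem loopErasureKeepLast_eq_loopErasure (p : InteriorWalk bd a b) (hb : b ∈ bd) (hab : a ≠ b) :
    p.1.loopErasureKeepLast = p.1.loopErasure := by
  obtain ⟨p, hlen, hint⟩ := p
  cases p with
  | nil => exact absurd rfl hab
  | cons q e =>
      have hq : b ∉ q.vertices := by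
        intro hbq
        have hne := q.vertices_ne_nil
        have hhead : q.vertices = a :: q.vertices.tail := by
          conv_lhs => rw [← List.cons_head_tail hne]
          simp
        rw [hhead] at hbq
        rcases List.mem_cons.1 hbq with h | h
        · exact hab h.symm
        · refine hint b ?_ hb
          rw [Path.vertices_cons, hhead]
          simpa using h
      have hq' : b ∉ q.loopErasure.vertices := fun h => hq (q.vertices_loopErasure_subset h)
      simp only [Path.loopErasureKeepLast]
      rw [Path.loopErasure, dif_neg hq']

end InteriorWalk

/-- The hitting matrix: `X(a, b)` is the sum of the weights of all walks of nonzero length from `a`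
to `b` through the interior. -/
noncomputable def hittingMatrix {V : Type*} [Quiver V] {R : Type*} [CommSemiring R]
    [TopologicalSpace R] (bd : Set V) (w : Total V → R) (a b : V) : R :=
  ∑' p : InteriorWalk bd a b, p.weight w

/-- The submatrix `X_{A,B} = (X(a_i, b_j))` of the hitting matrix. -/
noncomputable def hittingSubmatrix {V : Type*} [Quiver V] {R : Type*} [CommSemiring R]
    [TopologicalSpace R] (bd : Set V) (w : Total V → R) {k : ℕ} (a b : Fin k → V) :
    Matrix (Fin k) (Fin k) R :=
  Matrix.of fun i j => hittingMatrix bd w (a i) (b j)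

/-- The families of interior walks `π_i` from `a_i` to `b_i` such that `π_{i+1}` has no common
vertices with the loop-erased part of `π_i` in the interior. -/
def LoopErasedFamily {V : Type*} [Quiver V] (bd : Set V) {k : ℕ} (a b : Fin k → V) : Type _ :=
  {π : ∀ i, InteriorWalk bd (a i) (b i) //
    ∀ i j : Fin k, (i : ℕ) + 1 = j → ∀ v ∉ bd, v ∈ (π j).vertices → v ∉ (π i).loopErasedVertices}

/-- The weight `w(π_1) ⋯ w(π_k)` of a family. -/
def LoopErasedFamily.weight {V : Type*} [Quiver V] {bd : Set V} {k : ℕ} {a b : Fin k → V}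
    {R : Type*} [CommSemiring R] (w : Total V → R) (π : LoopErasedFamily bd a b) : R :=
  ∏ i, (π.1 i).weight w

/-- A real matrix is totally nonnegative if all its minors are nonnegative. -/
def IsTotallyNonnegative {k : ℕ} (M : Matrix (Fin k) (Fin k) ℝ) : Prop :=
  ∀ (r : ℕ) (f g : Fin r ↪o Fin k), 0 ≤ (M.submatrix f g).det

/-! The determinant is multilinear in the rows, so it expands into a signed sum over families in
which the walk from `a i` may end at any `b j`. As in the Lindström–Gessel–Viennot argument, a
sign-reversing involution cancels the bad families. A family is bad when some walk meets, at an
interior vertex, the loop-erased part of an earlier one.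

In a bad family take the least such `i`, the first vertex `v` on the loop-erased part of `π i` that
lies on a later walk, and the first later walk `π j` through `v`. Exchange the parts of `π i` and `π
j` after their last visits to `v`. The weight is kept and two end points are swapped, so the sign
changes. The crossing data survive (`isFirstCrossing_exchange`): if `h` is the part of `π i` up to
its last visit to `v`, neither final segment returns to the loop-erased part of `h` after `v`. Hence
that part remains an initial segment of the new loop-erased walk, and the exchange undoes itself.

The crossing hypothesis enters only for the surviving families. If their end points are distinct, it
forces them to be in order (`IsNoncrossing.fst_eq`). It also makes the condition on consecutive
walks imply the one on all pairs (`isNoncrossing_toWalkFamily`). Families with repeated end points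
contribute zero.

Convergence is separated from the combinatorics: once the signed weights are summable, continuity of
the determinant gives the expansion. Summability holds for power series because few walks divide a
given monomial, and over the reals by absolute convergence. -/

namespace Quiver.Path

variable {V : Type*} [Quiver V]

/-! ### Vertex lists of walks -/

theorem cons_tail_vertices {a b : V} (p : Path a b) : a :: p.vertices.tail = p.vertices := by
  conv_rhs => rw [← List.cons_head_tail p.vertices_ne_nil]
  simp

theorem vertices_comp_eq_append_tail {a b c : V} (p : Path a b) (q : Path b c) :
    (p.comp q).vertices = p.vertices ++ q.vertices.tail := by
  rw [vertices_comp, ← cons_tail_vertices q, List.append_cons, dropLast_append_end_eq,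
    List.tail_cons]

theorem mem_vertices_comp {a b c v : V} {p : Path a b} {q : Path b c} :
    v ∈ (p.comp q).vertices ↔ v ∈ p.vertices ∨ v ∈ q.vertices.tail := by
  rw [vertices_comp_eq_append_tail, List.mem_append]

theorem tail_vertices_comp {a b c : V} (p : Path a b) (q : Path b c) :
    (p.comp q).vertices.tail = p.vertices.tail ++ q.vertices.tail := by
  rw [vertices_comp_eq_append_tail, List.tail_append_of_ne_nil p.vertices_ne_nil]

theorem tail_vertices_ne_nil {a b : V} {p : Path a b} (hp : 0 < p.length) :
    p.vertices.tail ≠ [] := by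
  rw [← List.length_pos_iff_ne_nil]
  simpa using hp

theorem dropLast_tail_vertices_append {a b : V} {p : Path a b} (hp : 0 < p.length) :
    p.vertices.tail.dropLast ++ [b] = p.vertices.tail := by
  have h := List.dropLast_concat_getLast (tail_vertices_ne_nil hp)
  rwa [List.getLast_tail, vertices_getLast] at h

theorem mem_tail_vertices {a b v : V} {p : Path a b} (hp : 0 < p.length) :
    v ∈ p.vertices.tail ↔ v ∈ p.vertices.tail.dropLast ∨ v = b := by
  rw [← dropLast_tail_vertices_append hp]
  simp

theorem mem_vertices_iff {a b v : V} {p : Path a b} :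
    v ∈ p.vertices ↔ v = a ∨ v ∈ p.vertices.tail := by
  conv_lhs => rw [← cons_tail_vertices p]
  simp

theorem dropLast_tail_vertices_comp {a b c : V} (p : Path a b) {q : Path b c}
    (hq : 0 < q.length) :
    (p.comp q).vertices.tail.dropLast = p.vertices.tail ++ q.vertices.tail.dropLast := by
  rw [tail_vertices_comp, List.dropLast_append_of_ne_nil (tail_vertices_ne_nil hq)]

theorem dropLast_tail_vertices_cons {a b c : V} (p : Path a b) (e : b ⟶ c) :
    (p.cons e).vertices.tail.dropLast = p.vertices.tail := by
  simp [List.tail_append_of_ne_nil p.vertices_ne_nil]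

/-- The decomposition of a walk at its last visit to a vertex is unique. -/
theorem comp_inj_of_notMem_tail {a b v : V} {h h' : Path a v} {t t' : Path v b}
    (ht : v ∉ t.vertices.tail) (ht' : v ∉ t'.vertices.tail) (heq : h.comp t = h'.comp t') :
    h = h' ∧ t = t' := by
  suffices t.length = t'.length from comp_inj this |>.1 heq
  suffices ∀ {b : V} (t t' : Path v b) (h h' : Path a v), v ∉ t.vertices.tail →
      h.comp t = h'.comp t' → t.length ≤ t'.length from
    le_antisymm (this t t' h h' ht heq) (this t' t h' h ht' heq.symm)
  intro b t t' h h' ht heq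
  by_contra! hlt
  have hv := congrArg vertices heq
  have hlen := congrArg List.length hv
  rw [vertices_comp_eq_append_tail, vertices_comp_eq_append_tail] at hv
  -- If `t` were longer, `h'` would extend `h` by a nonempty piece of `t`, and that piece ends at
  -- `v`, which the tail of `t` avoids.
  obtain ⟨x, hx, hx'⟩ | ⟨x, hx, hx'⟩ := List.append_eq_append_iff.1 hv
  · rcases List.eq_nil_or_concat x with rfl | ⟨y, z, rfl⟩
    · have := congrArg List.length hx'
      simp at this
      omega
    · have hz : h'.vertices.getLast h'.vertices_ne_nil = z := by
        simp [hx]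
      rw [vertices_getLast] at hz
      subst hz
      apply ht
      rw [hx']
      simp
  · have := congrArg List.length hx'
    simp at this
    omega

/-! ### Loop erasure of a concatenation -/

theorem vertices_takeUntil {a : V} [DecidableEq V] : ∀ {b : V} (p : Path a b) (v : V)
    (hv : v ∈ p.vertices),
    (p.takeUntil v hv).vertices = p.vertices.takeWhile (· ≠ v) ++ [v]
  | _, nil, v, hv => by
      have h : v = a := by simpa using hv
      subst h
      simp [takeUntil]
  | _, cons p e, v, hv => by
      rw [takeUntil]
      split_ifs with h
      · rw [vertices_takeUntil p v h, vertices_cons, List.concat_eq_append, List.takeWhile_append,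
          if_neg]
        intro hl
        have := List.takeWhile_eq_self_iff.1 ((List.takeWhile_prefix _).eq_of_length hl) v h
        simp at this
      · have h' := ((mem_vertices_cons p e).1 hv).resolve_left h
        subst h'
        have : p.vertices.takeWhile (· ≠ v) = p.vertices :=
          List.takeWhile_eq_self_iff.2 fun x hx => by simpa using ne_of_mem_of_not_mem hx h
        rw [vertices_cons, List.concat_eq_append, List.takeWhile_append, this]
        simp

theorem nodup_vertices_loopErasure {a : V} : ∀ {b : V} (p : Path a b),
    p.loopErasure.vertices.Nodup
  | _, nil => by simp [loopErasure]
  | _, cons (c := c) p e => by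
      classical
      have ih := nodup_vertices_loopErasure p
      rw [loopErasure]
      split_ifs with h
      · rw [vertices_takeUntil, List.nodup_append]
        refine ⟨ih.sublist (List.takeWhile_sublist _), by simp, ?_⟩
        intro x hx y hy
        have := List.mem_takeWhile_imp hx
        simp_all
      · rw [vertices_cons, List.concat_eq_append, List.nodup_append]
        refine ⟨ih, by simp, ?_⟩
        rintro x hx y hy rfl
        simp at hy
        exact h (hy ▸ hx)

/-- If the walk `t` never returns to the loop-erased part of `h`, that part survives. -/
theorem vertices_loopErasure_prefix_comp {a v : V} (h : Path a v) : ∀ {b : V} (t : Path v b),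
    (∀ u ∈ t.vertices.tail, u ∉ h.loopErasure.vertices) →
    h.loopErasure.vertices <+: (h.comp t).loopErasure.vertices
  | _, nil, _ => by simp
  | _, cons (c := c) t e, ht => by
      classical
      have hmem : ∀ u, u ∈ (t.cons e).vertices.tail ↔ u ∈ t.vertices.tail ∨ u = c := by
        simp [List.tail_append_of_ne_nil t.vertices_ne_nil]
      have ih := vertices_loopErasure_prefix_comp h t fun u hu => ht u ((hmem u).2 (Or.inl hu))
      have hc := ht c ((hmem c).2 (Or.inr rfl))
      rw [comp_cons, loopErasure]
      split_ifs with hc'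
      · obtain ⟨s, hs⟩ := ih
        -- The loop closed at `c` is cut back only to `c`, which lies beyond the prefix, so the
        -- prefix is untouched.
        rw [vertices_takeUntil, ← hs, List.takeWhile_append_of_pos, List.append_assoc]
        · exact List.prefix_append _ _
        · intro x hx
          simpa using ne_of_mem_of_not_mem hx hc
      · rw [vertices_cons, List.concat_eq_append]
        exact ih.trans (List.prefix_append _ _)

/-- A vertex of the loop-erased part splits the walk, at its last visit, so that the rest of the
walk never returns to the loop-erased part of the initial segment. -/
theorem exists_eq_comp_of_mem_loopErasure {a v : V} : ∀ {b : V} (p : Path a b),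
    v ∈ p.loopErasure.vertices → ∃ (h : Path a v) (t : Path v b), p = h.comp t ∧
      ∀ u ∈ t.vertices.tail, u ∉ h.loopErasure.vertices
  | _, nil, hv => by
      obtain rfl : v = a := by simpa [loopErasure] using hv
      exact ⟨nil, nil, rfl, by simp⟩
  | _, cons (c := c) p e, hv => by
      classical
      by_cases hvc : v = c
      · subst hvc
        exact ⟨p.cons e, nil, rfl, by simp⟩
      -- Since `v` survives the step to `c`, it was already present before the step and, if a loop
      -- is closed there, it comes before `c`.
      have key : v ∈ p.loopErasure.vertices ∧ (c ∈ p.loopErasure.vertices →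
          v ∈ p.loopErasure.vertices.takeWhile (· ≠ c)) := by
        rw [loopErasure] at hv
        split_ifs at hv with h
        · rw [vertices_takeUntil] at hv
          have : v ∈ p.loopErasure.vertices.takeWhile (· ≠ c) := by simpa [hvc] using hv
          exact ⟨(List.takeWhile_sublist _).subset this, fun _ => this⟩
        · exact ⟨((mem_vertices_cons _ e).1 hv).resolve_right hvc, fun h' => absurd h' h⟩
      obtain ⟨h, t, rfl, ht⟩ := exists_eq_comp_of_mem_loopErasure p key.1
      refine ⟨h, t.cons e, rfl, ?_⟩
      intro u hu
      have hu' : u ∈ t.vertices.tail ∨ u = c := by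
        simpa [List.tail_append_of_ne_nil t.vertices_ne_nil] using hu
      rcases hu' with hu' | rfl
      · exact ht u hu'
      -- If the new vertex were on the loop-erased part of `h`, it would precede `v`, the end of
      -- that part. But `v` survives the step, so it precedes the new vertex; this contradicts
      -- self-avoidance.
      intro huh
      have hpre := vertices_loopErasure_prefix_comp h t ht
      have hv' := key.2 (hpre.subset huh)
      obtain ⟨s, hs⟩ := hpre
      have hnd := nodup_vertices_loopErasure (h.comp t)
      rw [← hs] at hv' hnd
      rw [← dropLast_append_end_eq h.loopErasure, List.mem_append] at huh
      have hu1 : u ∈ h.loopErasure.vertices.dropLast :=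
        huh.resolve_right fun h' => hvc (List.mem_singleton.1 h').symm
      rw [← dropLast_append_end_eq h.loopErasure, List.append_assoc, List.takeWhile_append,
        if_neg] at hv'
      · rw [← dropLast_append_end_eq h.loopErasure, List.append_assoc, List.nodup_append] at hnd
        exact hnd.2.2 v ((List.takeWhile_sublist _).subset hv') v (by simp) rfl
      · intro hl
        have := List.takeWhile_eq_self_iff.1 ((List.takeWhile_prefix _).eq_of_length hl) u hu1
        simp at this

end Quiver.Path

/-! ### Cutting a walk at its last visit to a vertex -/

namespace Quiver.Path

variable {V : Type*} [Quiver V]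

/-- The initial segment of a walk up to its last visit to `v`. -/
noncomputable def toLast {a b : V} (p : Path a b) (v : V) (hv : v ∈ p.vertices) : Path a v :=
  (p.exists_eq_comp_and_notMem_tail_of_mem_vertices hv).choose

/-- The final segment of a walk from its last visit to `v`. -/
noncomputable def fromLast {a b : V} (p : Path a b) (v : V) (hv : v ∈ p.vertices) : Path v b :=
  (p.exists_eq_comp_and_notMem_tail_of_mem_vertices hv).choose_spec.choose

theorem toLast_comp_fromLast {a b v : V} (p : Path a b) (hv : v ∈ p.vertices) :
    (p.toLast v hv).comp (p.fromLast v hv) = p :=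
  (p.exists_eq_comp_and_notMem_tail_of_mem_vertices hv).choose_spec.choose_spec.1.symm

theorem notMem_tail_vertices_fromLast {a b v : V} (p : Path a b) (hv : v ∈ p.vertices) :
    v ∉ (p.fromLast v hv).vertices.tail :=
  (p.exists_eq_comp_and_notMem_tail_of_mem_vertices hv).choose_spec.choose_spec.2

theorem eq_toLast_and_eq_fromLast {a b v : V} {p : Path a b} (hv : v ∈ p.vertices) {h : Path a v}
    {t : Path v b} (ht : v ∉ t.vertices.tail) (heq : p = h.comp t) :
    h = p.toLast v hv ∧ t = p.fromLast v hv :=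
  comp_inj_of_notMem_tail ht (p.notMem_tail_vertices_fromLast hv)
    (heq.symm.trans (p.toLast_comp_fromLast hv).symm)

theorem length_pos_of_ne {a b : V} (p : Path a b) (h : a ≠ b) : 0 < p.length :=
  Nat.pos_of_ne_zero fun h0 => h (p.eq_of_length_zero h0)

end Quiver.Path

/-! ### Splicing interior walks and splitting along the loop-erased part -/

namespace InteriorWalk

variable {V : Type*} [Quiver V] {bd : Set V} {a b a' b' v : V}

theorem notMem_bd_of_comp (p : InteriorWalk bd a b) {h : Path a v} {t : Path v b}
    (ht : 0 < t.length) (heq : p.1 = h.comp t) :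
    (∀ u ∈ h.vertices.tail, u ∉ bd) ∧ ∀ u ∈ t.vertices.tail.dropLast, u ∉ bd := by
  have := p.2.2
  rw [heq, Path.dropLast_tail_vertices_comp _ ht] at this
  exact ⟨fun u hu => this u (List.mem_append_left _ hu),
    fun u hu => this u (List.mem_append_right _ hu)⟩

/-- The concatenation of two walks through the interior at an interior vertex. -/
def ofComp (h : Path a v) (t : Path v b) (ht : 0 < t.length)
    (hh : ∀ u ∈ h.vertices.tail, u ∉ bd) (hi : ∀ u ∈ t.vertices.tail.dropLast, u ∉ bd) :
    InteriorWalk bd a b :=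
  ⟨h.comp t, by rw [Path.length_comp]; omega, by
    rw [Path.dropLast_tail_vertices_comp _ ht]
    intro u hu
    exact (List.mem_append.1 hu).elim (hh u) (hi u)⟩

/-- An interior walk following `p` up to its last visit to `v` and then `q` from its last visit
to `v`. -/
noncomputable def splice (p : InteriorWalk bd a b) (q : InteriorWalk bd a' b') (hb : b ∈ bd)
    (hb' : b' ∈ bd) (hv : v ∉ bd) (hp : v ∈ p.vertices) (hq : v ∈ q.vertices) :
    InteriorWalk bd a b' :=
  ofComp (p.1.toLast v hp) (q.1.fromLast v hq)
    (Path.length_pos_of_ne _ (ne_of_mem_of_not_mem hb' hv).symm)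
    (p.notMem_bd_of_comp (Path.length_pos_of_ne _ (ne_of_mem_of_not_mem hb hv).symm)
      (p.1.toLast_comp_fromLast hp).symm).1
    (q.notMem_bd_of_comp (Path.length_pos_of_ne _ (ne_of_mem_of_not_mem hb' hv).symm)
      (q.1.toLast_comp_fromLast hq).symm).2

section splice

variable (p : InteriorWalk bd a b) (q : InteriorWalk bd a' b') (hb : b ∈ bd)
    (hb' : b' ∈ bd) (hv : v ∉ bd) (hp : v ∈ p.vertices) (hq : v ∈ q.vertices)

theorem mem_vertices_splice_self : v ∈ (p.splice q hb hb' hv hp hq).vertices :=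
  Path.mem_vertices_comp.2 (Or.inl (Path.end_mem_vertices _))

theorem mem_vertices_of_mem_splice {u : V} (hu : u ∈ (p.splice q hb hb' hv hp hq).vertices) :
    u ∈ p.vertices ∨ u ∈ q.vertices := by
  rcases Path.mem_vertices_comp.1 hu with hu | hu
  · left
    rw [vertices, ← p.1.toLast_comp_fromLast hp]
    exact Path.mem_vertices_comp.2 (Or.inl hu)
  · right
    rw [vertices, ← q.1.toLast_comp_fromLast hq]
    exact Path.mem_vertices_comp.2 (Or.inr hu)

theorem toLast_splice (h : v ∈ (p.splice q hb hb' hv hp hq).1.vertices) :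
    (p.splice q hb hb' hv hp hq).1.toLast v h = p.1.toLast v hp :=
  (Path.eq_toLast_and_eq_fromLast h (q.1.notMem_tail_vertices_fromLast hq) rfl).1.symm

theorem fromLast_splice (h : v ∈ (p.splice q hb hb' hv hp hq).1.vertices) :
    (p.splice q hb hb' hv hp hq).1.fromLast v h = q.1.fromLast v hq :=
  (Path.eq_toLast_and_eq_fromLast h (q.1.notMem_tail_vertices_fromLast hq) rfl).2.symm

/-- The final segments avoid `v` after their start, so the cut at the last visit to `v` in a spliced
walk recovers the original pieces. -/
theorem splice_splice
    (h : v ∈ (p.splice q hb hb' hv hp hq).vertices)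
    (h' : v ∈ (q.splice p hb' hb hv hq hp).vertices) :
    (p.splice q hb hb' hv hp hq).splice (q.splice p hb' hb hv hq hp) hb' hb hv h h' = p := by
  apply Subtype.ext
  exact (congrArg₂ Path.comp (toLast_splice p q hb hb' hv hp hq h)
    (fromLast_splice q p hb' hb hv hq hp h')).trans (p.1.toLast_comp_fromLast hp)

theorem weight_splice_mul_weight_splice {R : Type*} [CommSemiring R] (w : Total V → R) :
    (p.splice q hb hb' hv hp hq).weight w * (q.splice p hb' hb hv hq hp).weight w =
      p.weight w * q.weight w := by
  conv_rhs => rw [weight, weight, ← p.1.toLast_comp_fromLast hp, ← q.1.toLast_comp_fromLast hq]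
  simp only [weight, splice, ofComp, Path.weight_comp]
  ring

end splice

/-- `p = h t` and the walk `t` avoids the loop-erased part of `h` before its end point. -/
structure IsErasureSplit (p : InteriorWalk bd a b) (h : Path a v) (t : Path v b) : Prop where
  eq_comp : p.1 = h.comp t
  length_pos : 0 < t.length
  notMem : ∀ u ∈ t.vertices.tail.dropLast, u ∉ h.loopErasure.vertices

theorem IsErasureSplit.prefix_loopErasedVertices {p : InteriorWalk bd a b} {h : Path a v}
    {t : Path v b} (H : p.IsErasureSplit h t) :
    h.loopErasure.vertices <+: p.loopErasedVertices := by
  obtain ⟨p, hp⟩ := p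
  obtain ⟨rfl : p = _, hpos, hn⟩ := H
  cases t with
  | nil => simp at hpos
  | cons t e =>
    -- The last step is kept unconditionally, so only the vertices of `t` before its end need to
    -- avoid the loop-erased part.
    rw [Path.dropLast_tail_vertices_cons] at hn
    refine (Path.vertices_loopErasure_prefix_comp h t hn).trans ?_
    simp [loopErasedVertices, Path.loopErasureKeepLast]

/-- The loop-erased part of `h` ends at `v`, so an erasure split is necessarily the cut at the last
visit to `v`, and is therefore unique. -/
theorem IsErasureSplit.notMem_tail {p : InteriorWalk bd a b} {h : Path a v}
    {t : Path v b} (H : p.IsErasureSplit h t) (hb : b ∈ bd) (hv : v ∉ bd) :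
    v ∉ t.vertices.tail := by
  rw [Path.mem_tail_vertices H.length_pos]
  rintro (h' | rfl)
  · exact H.notMem v h' (Path.end_mem_vertices _)
  · exact hv hb

theorem exists_isErasureSplit {p : InteriorWalk bd a b} (hb : b ∈ bd) (hv : v ∉ bd)
    (hvp : v ∈ p.loopErasedVertices) : ∃ (h : Path a v) (t : Path v b), p.IsErasureSplit h t := by
  obtain ⟨p, hp, hi⟩ := p
  cases p with
  | nil => simp at hp
  | cons p e =>
    have : v ∈ p.loopErasure.vertices :=
      ((Path.mem_vertices_cons _ e).1 hvp).resolve_right (ne_of_mem_of_not_mem hb hv).symm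
    obtain ⟨h, t, rfl, ht⟩ := Path.exists_eq_comp_of_mem_loopErasure p this
    exact ⟨h, t.cons e, rfl, by simp, by rwa [Path.dropLast_tail_vertices_cons]⟩

theorem IsErasureSplit.mem_loopErasedVertices {p : InteriorWalk bd a b} {h : Path a v}
    {t : Path v b} (H : p.IsErasureSplit h t) : v ∈ p.loopErasedVertices :=
  H.prefix_loopErasedVertices.subset (Path.end_mem_vertices _)

theorem loopErasedVertices_subset (p : InteriorWalk bd a b) :
    p.loopErasedVertices ⊆ p.vertices := by
  obtain ⟨p, hp, hi⟩ := p
  cases p with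
  | nil => simp at hp
  | cons p e =>
    intro u hu
    rcases (Path.mem_vertices_cons _ e).1 hu with hu | hu
    · exact (Path.mem_vertices_cons _ e).2 (Or.inl (p.vertices_loopErasure_subset hu))
    · exact (Path.mem_vertices_cons _ e).2 (Or.inr hu)

/-- A walk also splits at the earlier vertices of its loop-erased part, and does so earlier. -/
theorem IsErasureSplit.exists_shorter {p : InteriorWalk bd a b} {h : Path a v}
    {t : Path v b} (H : p.IsErasureSplit h t) {u : V} (hu : u ∈ h.loopErasure.vertices)
    (huv : u ≠ v) :
    ∃ (h' : Path a u) (t' : Path u b), p.IsErasureSplit h' t' ∧ h'.length < h.length := by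
  obtain ⟨h', s, rfl, hs⟩ := Path.exists_eq_comp_of_mem_loopErasure h hu
  refine ⟨h', s.comp t, ⟨by rw [H.eq_comp, Path.comp_assoc], ?_, ?_⟩, ?_⟩
  · have := H.length_pos
    rw [Path.length_comp]
    omega
  · rw [Path.dropLast_tail_vertices_comp _ H.length_pos]
    intro x hx hx'
    rcases List.mem_append.1 hx with hx | hx
    · exact hs x hx hx'
    · exact H.notMem x hx ((Path.vertices_loopErasure_prefix_comp h' s hs).subset hx')
  · have := s.length_pos_of_ne huv
    rw [Path.length_comp]
    omega

/-- The loop-erased part of an interior walk, as an interior walk. -/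
theorem exists_vertices_eq_loopErasedVertices (p : InteriorWalk bd a b) :
    ∃ q : InteriorWalk bd a b, q.vertices = p.loopErasedVertices := by
  obtain ⟨p, hp, hi⟩ := p
  cases p with
  | nil => simp at hp
  | cons p e =>
    rw [Path.dropLast_tail_vertices_cons] at hi
    refine ⟨⟨p.loopErasure.cons e, by simp, ?_⟩, rfl⟩
    rw [Path.dropLast_tail_vertices_cons]
    intro u hu
    refine hi u ?_
    -- The start `a` may be a boundary vertex, but self-avoidance confines it to the head of the
    -- loop-erased walk.
    have h1 := p.vertices_loopErasure_subset (List.mem_of_mem_tail hu)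
    refine (Path.mem_vertices_iff.1 h1).resolve_left ?_
    rintro rfl
    have := p.nodup_vertices_loopErasure
    rw [← Path.cons_tail_vertices] at this
    exact (List.nodup_cons.1 this).1 hu

end InteriorWalk

/-- The families of interior walks in which the `i`-th walk starts at `a i` and ends at any of the
`b j`. -/
abbrev WalkFamily {V : Type*} [Quiver V] (bd : Set V) {k : ℕ} (a b : Fin k → V) : Type _ :=
  ∀ i, Σ j, InteriorWalk bd (a i) (b j)

/-! ### First crossings and the sign-reversing exchange -/

namespace WalkFamily

variable {V : Type*} [Quiver V] {bd : Set V} {k : ℕ} {a b : Fin k → V}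

/-- No walk of the family has an interior vertex in common with the loop-erased part of an earlier
one. -/
def IsNoncrossing (π : WalkFamily bd a b) : Prop :=
  ∀ i j, i < j → ∀ v ∉ bd, v ∈ (π j).2.vertices → v ∉ (π i).2.loopErasedVertices

/-- The first place where a family fails to be noncrossing: `i` is minimal such that a later walk
meets the loop-erased part of the `i`-th one, `v` is the first vertex on that loop-erased part which
belongs to a later walk, and the `j`-th walk is the first one that visits it. -/
structure IsFirstCrossing (π : WalkFamily bd a b) (i j : Fin k) (v : V) : Prop where
  lt : i < j
  notMem_bd : v ∉ bd
  mem : v ∈ (π j).2.vertices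
  notMem_of_lt : ∀ h < i, ∀ l, h < l → ∀ u ∉ bd, u ∈ (π l).2.vertices →
    u ∉ (π h).2.loopErasedVertices
  exists_split : ∃ (h : Path (a i) v) (t : Path v (b (π i).1)), (π i).2.IsErasureSplit h t ∧
    ∀ u ∈ h.loopErasure.vertices, u ∉ bd → ∀ l, i < l → u ∈ (π l).2.vertices → u = v
  notMem_of_lt_of_lt : ∀ l, i < l → l < j → v ∉ (π l).2.vertices

theorem exists_isFirstCrossing (hb : ∀ j, b j ∈ bd) {π : WalkFamily bd a b}
    (hπ : ¬ π.IsNoncrossing) : ∃ i j v, π.IsFirstCrossing i j v := by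
  classical
  let P : Fin k → Prop := fun i => ∃ j, i < j ∧ ∃ v ∉ bd, v ∈ (π j).2.vertices ∧
    v ∈ (π i).2.loopErasedVertices
  have hP : ∃ i, P i := by
    simp only [IsNoncrossing] at hπ
    push Not at hπ
    obtain ⟨i, j, hij, v, hv, h1, h2⟩ := hπ
    exact ⟨i, j, hij, v, hv, h1, h2⟩
  obtain ⟨i, hi, hmin⟩ := WellFounded.has_min (wellFounded_lt (α := Fin k)) {i | P i} hP
  -- The first vertex on the loop-erased part is found by minimizing the length of `h`: by
  -- `exists_shorter`, an earlier candidate on it would give a shorter initial segment.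
  let Q : ℕ → Prop := fun n => ∃ v ∉ bd, (∃ j, i < j ∧ v ∈ (π j).2.vertices) ∧
    ∃ (h : Path (a i) v) (t : Path v (b (π i).1)), (π i).2.IsErasureSplit h t ∧ h.length = n
  have hQ : ∃ n, Q n := by
    obtain ⟨j, hij, v, hv, h1, h2⟩ := hi
    obtain ⟨h, t, H⟩ := InteriorWalk.exists_isErasureSplit (hb _) hv h2
    exact ⟨_, v, hv, ⟨j, hij, h1⟩, h, t, H, rfl⟩
  obtain ⟨v, hv, hj, h, t, H, hlen⟩ := Nat.find_spec hQ
  obtain ⟨j, hj, hjmin⟩ := WellFounded.has_min (wellFounded_lt (α := Fin k))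
    {j | i < j ∧ v ∈ (π j).2.vertices} hj
  refine ⟨i, j, v, hj.1, hv, hj.2, ?_, ⟨h, t, H, ?_⟩, ?_⟩
  · intro h hhi l hl u hu h1 h2
    exact hmin h ⟨l, hl, u, hu, h1, h2⟩ hhi
  · intro u hu hubd l hl hul
    by_contra huv
    obtain ⟨h', t', H', hlt⟩ := H.exists_shorter hu huv
    rw [hlen] at hlt
    exact Nat.find_min hQ hlt ⟨u, hubd, ⟨l, hl, hul⟩, h', t', H', rfl⟩
  · intro l hl hlj hvl
    exact hjmin l ⟨hl, hvl⟩ hlj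

theorem IsFirstCrossing.not_isNoncrossing {π : WalkFamily bd a b} {i j : Fin k} {v : V}
    (H : π.IsFirstCrossing i j v) : ¬ π.IsNoncrossing := by
  obtain ⟨h, t, hs, -⟩ := H.exists_split
  exact fun hπ => hπ i j H.lt v H.notMem_bd H.mem hs.mem_loopErasedVertices

/-- Minimality settles `i` and `j`. For the vertex, the two loop-erased initial segments are
prefixes of one list, hence comparable; so one of `v`, `v'` lies on the segment ending at the other,
where no second crossing vertex is allowed. -/
theorem IsFirstCrossing.unique {π : WalkFamily bd a b} {i j i' j' : Fin k} {v v' : V}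
    (H : π.IsFirstCrossing i j v) (H' : π.IsFirstCrossing i' j' v') :
    i = i' ∧ j = j' ∧ v = v' := by
  obtain ⟨h, t, hs, hf⟩ := H.exists_split
  obtain ⟨h', t', hs', hf'⟩ := H'.exists_split
  obtain rfl : i = i' := by
    rcases lt_trichotomy i i' with hlt | heq | hlt
    · exact absurd hs.mem_loopErasedVertices
        (H'.notMem_of_lt i hlt j H.lt v H.notMem_bd H.mem)
    · exact heq
    · exact absurd hs'.mem_loopErasedVertices
        (H.notMem_of_lt i' hlt j' H'.lt v' H'.notMem_bd H'.mem)
  obtain rfl : v = v' := by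
    rcases List.prefix_or_prefix_of_prefix hs.prefix_loopErasedVertices
      hs'.prefix_loopErasedVertices with hp | hp
    · exact hf' v (hp.subset (Path.end_mem_vertices _)) H.notMem_bd j H.lt H.mem
    · exact (hf v' (hp.subset (Path.end_mem_vertices _)) H'.notMem_bd j' H'.lt H'.mem).symm
  refine ⟨rfl, ?_, rfl⟩
  rcases lt_trichotomy j j' with hlt | heq | hlt
  · exact absurd H.mem (H'.notMem_of_lt_of_lt j H.lt hlt)
  · exact heq
  · exact absurd H'.mem (H.notMem_of_lt_of_lt j' H'.lt hlt)

theorem IsFirstCrossing.mem_left {π : WalkFamily bd a b} {i j : Fin k} {v : V}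
    (H : π.IsFirstCrossing i j v) : v ∈ (π i).2.vertices := by
  obtain ⟨h, t, hs, -⟩ := H.exists_split
  exact (π i).2.loopErasedVertices_subset hs.mem_loopErasedVertices

/-- Exchange the final segments of the `i`-th and the `j`-th walk after their last visits to the
first crossing. -/
noncomputable def exchange (hb : ∀ j, b j ∈ bd) (π : WalkFamily bd a b) {i j : Fin k} {v : V}
    (H : π.IsFirstCrossing i j v) : WalkFamily bd a b :=
  Function.update (Function.update π i
    ⟨(π j).1, (π i).2.splice (π j).2 (hb _) (hb _) H.notMem_bd H.mem_left H.mem⟩) j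
    ⟨(π i).1, (π j).2.splice (π i).2 (hb _) (hb _) H.notMem_bd H.mem H.mem_left⟩

section exchange

variable (hb : ∀ j, b j ∈ bd) {π : WalkFamily bd a b} {i j : Fin k} {v : V}
    (H : π.IsFirstCrossing i j v)

theorem exchange_left : π.exchange hb H i =
    ⟨(π j).1, (π i).2.splice (π j).2 (hb _) (hb _) H.notMem_bd H.mem_left H.mem⟩ := by
  rw [exchange, Function.update_of_ne H.lt.ne, Function.update_self]

theorem exchange_right : π.exchange hb H j =
    ⟨(π i).1, (π j).2.splice (π i).2 (hb _) (hb _) H.notMem_bd H.mem H.mem_left⟩ := by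
  rw [exchange, Function.update_self]

theorem exchange_of_ne {l : Fin k} (hi : l ≠ i) (hj : l ≠ j) : π.exchange hb H l = π l := by
  rw [exchange, Function.update_of_ne hj, Function.update_of_ne hi]

/-- The exchange only redistributes vertices among walks with index at least `i`, so it creates no
crossing with the walks before `i`. -/
theorem exists_mem_vertices_of_mem_exchange {l : Fin k} {u : V}
    (hu : u ∈ (π.exchange hb H l).2.vertices) :
    u ∈ (π l).2.vertices ∨ ∃ m, i ≤ m ∧ u ∈ (π m).2.vertices := by
  by_cases hi : l = i
  · subst hi
    rw [exchange_left] at hu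
    rcases InteriorWalk.mem_vertices_of_mem_splice _ _ (hb _) (hb _) H.notMem_bd H.mem_left H.mem hu
      with hu | hu
    · exact Or.inl hu
    · exact Or.inr ⟨j, H.lt.le, hu⟩
  by_cases hj : l = j
  · subst hj
    rw [exchange_right] at hu
    rcases InteriorWalk.mem_vertices_of_mem_splice _ _ (hb _) (hb _) H.notMem_bd H.mem H.mem_left hu
      with hu | hu
    · exact Or.inl hu
    · exact Or.inr ⟨i, le_rfl, hu⟩
  rw [exchange_of_ne hb H hi hj] at hu
  exact Or.inl hu

/-- The exchange leaves the initial segment `h` of `π i` intact, and both final segments avoid its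
loop-erased part after `v`. Preservation of the crossing is what makes the exchange an involution.
-/
theorem isFirstCrossing_exchange : (π.exchange hb H).IsFirstCrossing i j v := by
  have hmem : v ∈ (π.exchange hb H j).2.vertices := by
    rw [exchange_right]
    exact InteriorWalk.mem_vertices_splice_self _ _ (hb _) (hb _) H.notMem_bd H.mem H.mem_left
  refine ⟨H.lt, H.notMem_bd, hmem, ?_, ?_, ?_⟩
  · intro h hhi l hl u hu hul
    rw [exchange_of_ne hb H hhi.ne (hhi.trans H.lt).ne]
    rcases exists_mem_vertices_of_mem_exchange hb H hul with hul | ⟨m, hm, hul⟩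
    · exact H.notMem_of_lt h hhi l hl u hu hul
    · exact H.notMem_of_lt h hhi m (hhi.trans_le hm) u hu hul
  · obtain ⟨h, t, hs, hf⟩ := H.exists_split
    obtain ⟨rfl, rfl⟩ := Path.eq_toLast_and_eq_fromLast H.mem_left
      (hs.notMem_tail (hb _) H.notMem_bd) hs.eq_comp
    rw [exchange_left]
    have hpos : 0 < ((π j).2.1.fromLast v H.mem).length :=
      Path.length_pos_of_ne _ (ne_of_mem_of_not_mem (hb _) H.notMem_bd).symm
    refine ⟨_, _, ⟨rfl, hpos, ?_⟩, ?_⟩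
    · intro u hu huh
      have htail : u ∈ ((π j).2.1.fromLast v H.mem).vertices.tail :=
        (Path.mem_tail_vertices hpos).2 (Or.inl hu)
      have hubd : u ∉ bd := ((π j).2.notMem_bd_of_comp hpos
        ((π j).2.1.toLast_comp_fromLast H.mem).symm).2 u hu
      have huj : u ∈ (π j).2.vertices := by
        rw [InteriorWalk.vertices, ← (π j).2.1.toLast_comp_fromLast H.mem]
        exact Path.mem_vertices_comp.2 (Or.inr htail)
      -- A vertex of `π j` on the loop-erased part of `h` can only be `v`, which the final segment
      -- never revisits.
      obtain rfl := hf u huh hubd j H.lt huj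
      exact (π j).2.1.notMem_tail_vertices_fromLast H.mem htail
    · intro u hu hubd l hl hul
      by_cases hj : l = j
      · subst hj
        rw [exchange_right] at hul
        rcases Path.mem_vertices_comp.1 hul with hul | hul
        · refine hf u hu hubd l hl ?_
          rw [InteriorWalk.vertices, ← (π l).2.1.toLast_comp_fromLast H.mem]
          exact Path.mem_vertices_comp.2 (Or.inl hul)
        -- The new final segment of the later walk is `t`, which avoids the loop-erased part of `h`
        -- except possibly at its boundary end.
        · rcases (Path.mem_tail_vertices hs.length_pos).1 hul with hul | rfl
          · exact absurd hu (hs.notMem u hul)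
          · exact absurd (hb _) hubd
      · rw [exchange_of_ne hb H hl.ne' hj] at hul
        exact hf u hu hubd l hl hul
  · intro l hl hlj
    rw [exchange_of_ne hb H hl.ne' hlj.ne]
    exact H.notMem_of_lt_of_lt l hl hlj

theorem splice_congr {x y : V} {p p' : Σ l, InteriorWalk bd x (b l)}
    {q q' : Σ l, InteriorWalk bd y (b l)} (hp : p = p') (hq : q = q') {v : V} (hv : v ∉ bd)
    (h1 : v ∈ p.2.vertices) (h2 : v ∈ q.2.vertices) (h1' : v ∈ p'.2.vertices)
    (h2' : v ∈ q'.2.vertices) :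
    (⟨q.1, p.2.splice q.2 (hb _) (hb _) hv h1 h2⟩ : Σ l, InteriorWalk bd x (b l)) =
      ⟨q'.1, p'.2.splice q'.2 (hb _) (hb _) hv h1' h2'⟩ := by
  subst hp hq
  rfl

theorem exchange_exchange {i' j' : Fin k} {v' : V}
    (H' : (π.exchange hb H).IsFirstCrossing i' j' v') :
    (π.exchange hb H).exchange hb H' = π := by
  obtain ⟨rfl, rfl, rfl⟩ := (isFirstCrossing_exchange hb H).unique H'
  funext l
  have hl := InteriorWalk.mem_vertices_splice_self (π i).2 (π j).2 (hb _) (hb _) H.notMem_bd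
    H.mem_left H.mem
  have hr := InteriorWalk.mem_vertices_splice_self (π j).2 (π i).2 (hb _) (hb _) H.notMem_bd
    H.mem H.mem_left
  by_cases hi : l = i
  · subst hi
    rw [exchange_left]
    refine (splice_congr hb (exchange_left hb H) (exchange_right hb H) _ _ _ hl hr).trans ?_
    exact Sigma.ext rfl (heq_of_eq (InteriorWalk.splice_splice _ _ _ _ _ _ _ _ _))
  by_cases hj : l = j
  · subst hj
    rw [exchange_right]
    refine (splice_congr hb (exchange_right hb H) (exchange_left hb H) _ _ _ hr hl).trans ?_
    exact Sigma.ext rfl (heq_of_eq (InteriorWalk.splice_splice _ _ _ _ _ _ _ _ _))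
  rw [exchange_of_ne hb H' hi hj, exchange_of_ne hb H hi hj]

end exchange

/-- The sign-reversing involution: it exchanges final segments at the first crossing, and fixes the
noncrossing families. -/
noncomputable def crossingInvolution (hb : ∀ j, b j ∈ bd) (π : WalkFamily bd a b) :
    WalkFamily bd a b :=
  open Classical in
  if H : ∃ i j v, π.IsFirstCrossing i j v then
    π.exchange hb H.choose_spec.choose_spec.choose_spec
  else π

theorem crossingInvolution_involutive (hb : ∀ j, b j ∈ bd) :
    Function.Involutive (crossingInvolution (a := a) hb) := by
  intro π
  by_cases H : ∃ i j v, π.IsFirstCrossing i j v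
  · have h1 : π.crossingInvolution hb = π.exchange hb H.choose_spec.choose_spec.choose_spec :=
      dif_pos H
    rw [h1]
    have H' : ∃ i j v,
        (π.exchange hb H.choose_spec.choose_spec.choose_spec).IsFirstCrossing i j v :=
      ⟨_, _, _, isFirstCrossing_exchange hb _⟩
    rw [crossingInvolution, dif_pos H', exchange_exchange]
  · rw [crossingInvolution, crossingInvolution, dif_neg H, dif_neg H]

/-! ### Signed weights -/

variable {R : Type*} [CommRing R]

/-- The contribution of a family to the determinant of the hitting matrix: the determinant of the
matrix whose `i`-th row has the weight of the `i`-th walk in the column of its end point. -/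
noncomputable def signedWeight (w : Total V → R) (π : WalkFamily bd a b) : R :=
  Matrix.detRowAlternating fun i => Pi.single (π i).1 ((π i).2.weight w)

/-- Separates the product of the weights from a factor that depends only on the end points: the sign
of a permutation, or zero when an end point repeats. -/
theorem signedWeight_eq (w : Total V → R) (π : WalkFamily bd a b) : π.signedWeight w =
    (∏ i, (π i).2.weight w) *
      (Matrix.of fun i => (Pi.single (π i).1 1 : Fin k → R)).det := by
  rw [← Matrix.det_mul_column]
  change Matrix.det _ = _
  congr 1
  ext i j
  simp [Pi.single_apply]

theorem signedWeight_exchange (w : Total V → R) (hb : ∀ j, b j ∈ bd) {π : WalkFamily bd a b}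
    {i j : Fin k} {v : V} (H : π.IsFirstCrossing i j v) :
    (π.exchange hb H).signedWeight w = - π.signedWeight w := by
  have hprod : ∏ l, (π.exchange hb H l).2.weight w = ∏ l, (π l).2.weight w := by
    have hj : j ∈ Finset.univ.erase i := by simp [H.lt.ne']
    rw [← Finset.mul_prod_erase _ _ (Finset.mem_univ i), ← Finset.mul_prod_erase _ _ hj,
      ← Finset.mul_prod_erase _ (fun l => (π l).2.weight w) (Finset.mem_univ i),
      ← Finset.mul_prod_erase _ (fun l => (π l).2.weight w) hj, ← mul_assoc, ← mul_assoc]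
    congr 1
    · rw [exchange_left, exchange_right]
      exact InteriorWalk.weight_splice_mul_weight_splice _ _ (hb _) (hb _) H.notMem_bd
        H.mem_left H.mem w
    · refine Finset.prod_congr rfl fun l hl => ?_
      simp only [Finset.mem_erase] at hl
      rw [exchange_of_ne hb H hl.2.1 hl.1]
  have hrows : (Matrix.of fun l => (Pi.single (π.exchange hb H l).1 1 : Fin k → R)) =
      (Matrix.of fun l => (Pi.single (π l).1 1 : Fin k → R)).submatrix (Equiv.swap i j) id := by
    ext l m
    simp only [Matrix.of_apply, Matrix.submatrix_apply, id]
    by_cases hi : l = i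
    · subst hi
      rw [exchange_left, Equiv.swap_apply_left]
    by_cases hj : l = j
    · subst hj
      rw [exchange_right, Equiv.swap_apply_right]
    rw [exchange_of_ne hb H hi hj, Equiv.swap_apply_of_ne_of_ne hi hj]
  rw [signedWeight_eq, signedWeight_eq, hprod, hrows, Matrix.det_permute,
    Equiv.Perm.sign_swap H.lt.ne]
  simp

theorem signedWeight_crossingInvolution (w : Total V → R) (hb : ∀ j, b j ∈ bd)
    {π : WalkFamily bd a b} (hπ : ¬ π.IsNoncrossing) :
    (π.crossingInvolution hb).signedWeight w = - π.signedWeight w := by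
  rw [crossingInvolution, dif_pos (exists_isFirstCrossing hb hπ), signedWeight_exchange]

theorem isNoncrossing_crossingInvolution (hb : ∀ j, b j ∈ bd) (π : WalkFamily bd a b) :
    (π.crossingInvolution hb).IsNoncrossing ↔ π.IsNoncrossing := by
  by_cases H : ∃ i j v, π.IsFirstCrossing i j v
  · have h1 : π.crossingInvolution hb = π.exchange hb H.choose_spec.choose_spec.choose_spec :=
      dif_pos H
    rw [h1]
    exact iff_of_false (isFirstCrossing_exchange hb _).not_isNoncrossing
      H.choose_spec.choose_spec.choose_spec.not_isNoncrossing
  · rw [crossingInvolution, dif_neg H]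

end WalkFamily

/-- A continuous multilinear expression in sums of families is the sum of its values on all choices
of members of the families, provided that these values are summable. -/
theorem MultilinearMap.hasSum_of_summable {ι R : Type*} [Fintype ι] [CommSemiring R]
    {E : ι → Type*} [∀ i, AddCommMonoid (E i)] [∀ i, Module R (E i)]
    [∀ i, TopologicalSpace (E i)] {F : Type*} [AddCommMonoid F] [Module R F] [TopologicalSpace F]
    [T2Space F] (M : MultilinearMap R E F) (hM : Continuous M) {α : ι → Type*}
    {f : ∀ i, α i → E i} {s : ∀ i, E i} (hf : ∀ i, HasSum (f i) (s i))
    (hsum : Summable fun x : ∀ i, α i => M fun i => f i (x i)) :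
    HasSum (fun x : ∀ i, α i => M fun i => f i (x i)) (M s) := by
  classical
  obtain ⟨T, hT⟩ := hsum
  -- The partial sums over boxes have two limits: they are cofinal among all finite partial sums,
  -- and by multilinearity they are `M` applied to partial sums of each family.
  have h1 : Filter.Tendsto (fun S : ∀ i, Finset (α i) => M fun i => ∑ x ∈ S i, f i x)
      Filter.atTop (nhds T) := by
    have hbox : Filter.Tendsto (fun S : ∀ i, Finset (α i) => Fintype.piFinset S)
        Filter.atTop Filter.atTop := by
      refine Filter.tendsto_atTop_atTop_of_monotone
        (fun S S' h => Fintype.piFinset_subset _ _ h) fun A => ?_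
      refine ⟨fun i => A.image fun x => x i, fun x hx => ?_⟩
      exact Fintype.mem_piFinset.2 fun i => Finset.mem_image_of_mem _ hx
    rw [HasSum, SummationFilter.unconditional_filter] at hT
    refine (hT.comp hbox).congr fun S => ?_
    exact (M.map_sum_finset _ _).symm
  have h2 : Filter.Tendsto (fun S : ∀ i, Finset (α i) => M fun i => ∑ x ∈ S i, f i x)
      Filter.atTop (nhds (M s)) := by
    refine (hM.tendsto s).comp (tendsto_pi_nhds.2 fun i => ?_)
    have hi := hf i
    rw [HasSum, SummationFilter.unconditional_filter] at hi
    exact hi.comp (Filter.tendsto_atTop_atTop_of_monotone (fun S S' h => h i)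
      fun A => ⟨fun j => if h : j = i then h ▸ A else ∅, by simp⟩)
  rwa [tendsto_nhds_unique h1 h2] at hT

/-! ### Noncrossing families under the crossing condition -/

namespace LoopErasedFamily

variable {V : Type*} [Quiver V] {bd : Set V} {k : ℕ} {a b : Fin k → V}

/-- A loop-erased family, as a family of walks with arbitrary end points. -/
def toWalkFamily (π : LoopErasedFamily bd a b) : WalkFamily bd a b :=
  fun i => ⟨i, π.1 i⟩

theorem toWalkFamily_injective :
    Function.Injective (toWalkFamily : LoopErasedFamily bd a b → WalkFamily bd a b) := by
  intro π π' h
  refine Subtype.ext (funext fun i => ?_)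
  exact eq_of_heq (Sigma.mk.inj (congrFun h i)).2

/-- Under the crossing condition it is enough to compare consecutive walks. -/
theorem isNoncrossing_toWalkFamily (hb : ∀ j, b j ∈ bd)
    (hcross : ∀ i i' j j' : Fin k, i < i' → j' < j →
      ∀ (p : InteriorWalk bd (a i) (b j)) (q : InteriorWalk bd (a i') (b j')),
        ∃ v, v ∉ bd ∧ v ∈ p.vertices ∧ v ∈ q.vertices)
    (π : LoopErasedFamily bd a b) : π.toWalkFamily.IsNoncrossing := by
  -- Induction on the gap between the two indices.
  suffices ∀ (n : ℕ) (i j : Fin k), (i : ℕ) + 1 + n = j → ∀ v ∉ bd, v ∈ (π.1 j).vertices →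
      v ∉ (π.1 i).loopErasedVertices from
    fun i j hij => this (j - (i + 1)) i j (by have := Fin.lt_def.1 hij; omega)
  intro n
  induction n with
  | zero => exact fun i j hij => π.2 i j hij
  | succ n ih =>
    intro i j hij v hv hvj hvi
    have hj := j.2
    let m : Fin k := ⟨i + 1, by omega⟩
    obtain ⟨p, hp⟩ := (π.1 i).exists_vertices_eq_loopErasedVertices
    obtain ⟨q, hq⟩ := (π.1 m).exists_vertices_eq_loopErasedVertices
    rw [← hp] at hvi
    -- Following the loop-erased part of `π i` to `v` and then `π j` gives a walk from `a i` to `b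
    -- j`, which must meet the loop-erased part of the walk with index `m = i + 1`. The meeting
    -- vertex contradicts the condition on `i`, `m`, or the induction hypothesis for `m`, `j`.
    obtain ⟨u, hu, hup, huq⟩ := hcross i m j m (Fin.lt_def.2 (by simp [m]))
      (Fin.lt_def.2 (by simp only [m]; omega)) (p.splice (π.1 j) (hb i) (hb j) hv hvi hvj) q
    rw [hq] at huq
    rcases p.mem_vertices_of_mem_splice _ (hb i) (hb j) hv hvi hvj hup with hup | hup
    · rw [hp] at hup
      exact π.2 i m rfl u hu ((π.1 m).loopErasedVertices_subset huq) hup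
    · exact ih m j (by simp only [m]; omega) u hu hup huq

end LoopErasedFamily

namespace WalkFamily

variable {V : Type*} [Quiver V] {bd : Set V} {k : ℕ} {a b : Fin k → V}

/-- Under the crossing condition the walks of a noncrossing family with distinct end points end in
the order in which they start. -/
theorem IsNoncrossing.fst_eq
    (hcross : ∀ i i' j j' : Fin k, i < i' → j' < j →
      ∀ (p : InteriorWalk bd (a i) (b j)) (q : InteriorWalk bd (a i') (b j')),
        ∃ v, v ∉ bd ∧ v ∈ p.vertices ∧ v ∈ q.vertices)
    {π : WalkFamily bd a b} (hπ : π.IsNoncrossing)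
    (hinj : Function.Injective fun i => (π i).1) (i : Fin k) : (π i).1 = i := by
  have hmono : StrictMono fun i => (π i).1 := by
    intro i j hij
    by_contra! hle
    -- Applying the crossing condition to the loop-erased walk places the common vertex on the
    -- loop-erased part.
    obtain ⟨p, hp⟩ := (π i).2.exists_vertices_eq_loopErasedVertices
    obtain ⟨v, hv, hvp, hvj⟩ := hcross i j _ _ hij
      (lt_of_le_of_ne hle fun h => hij.ne' (hinj h)) p (π j).2
    exact hπ i j hij v hv hvj (hp ▸ hvp)
  exact congrFun ((hmono.range_inj strictMono_id).1 (by
    rw [(Finite.surjective_of_injective hinj).range_eq, Set.range_id])) i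

theorem IsNoncrossing.mem_range_toWalkFamily {π : WalkFamily bd a b} (hπ : π.IsNoncrossing)
    (h : ∀ i, (π i).1 = i) : π ∈ Set.range (LoopErasedFamily.toWalkFamily (bd := bd)) := by
  have hex : ∀ i, ∃ p : InteriorWalk bd (a i) (b i), π i = ⟨i, p⟩ := by
    intro i
    obtain ⟨p, hp⟩ : ∃ p, π i = p := ⟨_, rfl⟩
    obtain ⟨j, p⟩ := p
    obtain rfl : j = i := by rw [← h i, hp]
    exact ⟨p, hp⟩
  choose p hp using hex
  obtain rfl : π = fun i => ⟨i, p i⟩ := funext hp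
  exact ⟨⟨p, fun i j hij => hπ i j (Fin.lt_def.2 (by omega))⟩, rfl⟩

variable {R : Type*} [CommRing R]

theorem signedWeight_eq_zero (w : Total V → R) {π : WalkFamily bd a b}
    (h : ¬ Function.Injective fun i => (π i).1) : π.signedWeight w = 0 := by
  rw [Function.not_injective_iff] at h
  obtain ⟨i, j, hij, hne⟩ := h
  rw [signedWeight_eq, Matrix.det_zero_of_row_eq hne, mul_zero]
  exact congrArg (fun l => (Pi.single l 1 : Fin k → R)) hij

theorem signedWeight_toWalkFamily (w : Total V → R) (π : LoopErasedFamily bd a b) :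
    π.toWalkFamily.signedWeight w = π.weight w := by
  have h1 : (Matrix.of fun i => (Pi.single (π.toWalkFamily i).1 1 : Fin k → R)) = 1 := by
    ext i j
    simp [LoopErasedFamily.toWalkFamily, Matrix.one_apply, Pi.single_apply, eq_comm]
  rw [signedWeight_eq, h1, Matrix.det_one, mul_one]
  rfl

/-- Row `i` of the matrix is the sum, over walks from `a i` to any `b j`, of the weight times the
`j`-th unit vector; the determinant is continuous and multilinear in the rows. -/
theorem hasSum_signedWeight [TopologicalSpace R] [IsTopologicalRing R] [T2Space R]
    (w : Total V → R)
    (hw : ∀ i j, Summable fun p : InteriorWalk bd (a i) (b j) => p.weight w)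
    (hs : Summable fun π : WalkFamily bd a b => π.signedWeight w) :
    HasSum (fun π : WalkFamily bd a b => π.signedWeight w) (hittingSubmatrix bd w a b).det := by
  refine MultilinearMap.hasSum_of_summable
    (Matrix.detRowAlternating (n := Fin k) (R := R)).toMultilinearMap ?_
    (f := fun i (p : Σ j, InteriorWalk bd (a i) (b j)) => Pi.single p.1 (p.2.weight w))
    (fun i => ?_) hs
  · exact Continuous.matrix_det (continuous_id : Continuous fun M : Matrix (Fin k) (Fin k) R => M)
  · refine Pi.hasSum.2 fun j => ?_
    rw [← (sigma_mk_injective (i := j)).hasSum_iff]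
    · simpa [Function.comp_def, hittingSubmatrix, hittingMatrix] using (hw i j).hasSum
    · rintro ⟨l, p⟩ hl
      rw [Pi.single_eq_of_ne]
      rintro rfl
      exact hl ⟨p, rfl⟩

/-- Reindexing by the involution turns the sum into its own negative, and `hR` excludes 2-torsion.
-/
theorem tsum_indicator_signedWeight [TopologicalSpace R] [IsTopologicalRing R] [T2Space R]
    (hR : ∀ x : R, x = -x → x = 0) (hb : ∀ j, b j ∈ bd) (w : Total V → R) :
    ∑' π, {π : WalkFamily bd a b | ¬ π.IsNoncrossing}.indicator (fun π => π.signedWeight w) π =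
      0 := by
  classical
  apply hR
  conv_lhs => rw [← (crossingInvolution_involutive (a := a) hb).toPerm.tsum_eq]
  rw [← tsum_neg]
  refine tsum_congr fun π => ?_
  simp only [Function.Involutive.coe_toPerm, Set.indicator_apply, Set.mem_ofPred_eq,
    isNoncrossing_crossingInvolution]
  split_ifs with h
  · simp
  · exact signedWeight_crossingInvolution w hb h

end WalkFamily

theorem hasSum_weight_loopErasedFamily {V : Type*} [Quiver V] {bd : Set V} {k : ℕ}
    {a b : Fin k → V} {R : Type*} [CommRing R] [UniformSpace R] [IsUniformAddGroup R]
    [IsTopologicalRing R] [CompleteSpace R] [T2Space R] (hR : ∀ x : R, x = -x → x = 0)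
    (hb : ∀ j, b j ∈ bd)
    (hcross : ∀ i i' j j' : Fin k, i < i' → j' < j →
      ∀ (p : InteriorWalk bd (a i) (b j)) (q : InteriorWalk bd (a i') (b j')),
        ∃ v, v ∉ bd ∧ v ∈ p.vertices ∧ v ∈ q.vertices)
    (w : Total V → R)
    (hw : ∀ i j, Summable fun p : InteriorWalk bd (a i) (b j) => p.weight w)
    (hs : Summable fun π : WalkFamily bd a b => π.signedWeight w) :
    HasSum (fun π : LoopErasedFamily bd a b => π.weight w) (hittingSubmatrix bd w a b).det := by
  classical
  have h1 := WalkFamily.hasSum_signedWeight w hw hs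
  -- Completeness makes the crossing families summable on their own; their sum is zero and is
  -- subtracted.
  have h2 := (hs.indicator {π | ¬ π.IsNoncrossing}).hasSum
  rw [WalkFamily.tsum_indicator_signedWeight hR hb] at h2
  have h3 := h1.sub h2
  rw [sub_zero, ← LoopErasedFamily.toWalkFamily_injective.hasSum_iff] at h3
  · refine Eq.mp (congrArg (HasSum · _) (funext fun π => ?_)) h3
    simp [LoopErasedFamily.isNoncrossing_toWalkFamily hb hcross π,
      WalkFamily.signedWeight_toWalkFamily]
  · intro π hπ
    by_cases hnc : π.IsNoncrossing
    · by_cases hinj : Function.Injective fun i => (π i).1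
      · exact absurd (hnc.mem_range_toWalkFamily (hnc.fst_eq hcross hinj)) hπ
      · simp [hnc, WalkFamily.signedWeight_eq_zero w hinj]
    · simp [hnc]

/-! ### Summability for power series and for real weights -/

namespace Quiver.Path

variable {V : Type*} [Quiver V]

/-- The edges of a walk, the last one first. -/
def edges {a : V} : ∀ {b : V}, Path a b → List (Total V)
  | _, nil => []
  | _, cons p e => ⟨_, _, e⟩ :: edges p

theorem edges_injective {a : V} : ∀ {b c : V} (p : Path a b) (q : Path a c),
    p.edges = q.edges → (⟨b, p⟩ : Σ b, Path a b) = ⟨c, q⟩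
  | _, _, nil, nil, _ => rfl
  | _, _, nil, cons _ _, h => by simp [edges] at h
  | _, _, cons _ _, nil, h => by simp [edges] at h
  | _, _, cons p e, cons q f, h => by
      simp only [edges, List.cons.injEq, Total.mk.injEq] at h
      obtain ⟨⟨rfl, rfl, h1⟩, h2⟩ := h
      obtain rfl := eq_of_heq h1
      have := edges_injective p q h2
      simp only [Sigma.mk.injEq, heq_eq_eq, true_and] at this
      rw [this]

theorem weight_eq_prod_map_edges {R : Type*} [CommMonoid R] (w : Total V → R) {a : V} :
    ∀ {b : V} (p : Path a b),
      p.weight (fun {c d} (e : c ⟶ d) => w ⟨c, d, e⟩) = (p.edges.map w).prod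
  | _, nil => by simp [edges]
  | _, cons p e => by
      rw [weight_cons, weight_eq_prod_map_edges w p, edges, List.map_cons, List.prod_cons, mul_comm]

end Quiver.Path

/-- Even over an infinite alphabet, finitely many multisets lie below `d`, and each has finitely
many orderings. With `edges_injective` this bounds the walks whose monomial divides a given one. -/
theorem List.finite_setOf_toFinsupp_le {α : Type*} [DecidableEq α] (d : α →₀ ℕ) :
    {l : List α | Multiset.toFinsupp (l : Multiset α) ≤ d}.Finite := by
  refine (Set.finite_Iic d).preimage' fun m _ => ?_
  obtain ⟨l₀, hl₀⟩ := Quotient.exists_rep (Finsupp.toMultiset m)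
  refine (List.finite_toSet l₀.permutations).subset fun l hl => ?_
  have h : (l : Multiset α) = (l₀ : Multiset α) := by
    rw [← Multiset.toFinsupp_toMultiset (l : Multiset α)]
    exact (congrArg _ hl).trans hl₀.symm
  exact List.mem_permutations.2 (Multiset.coe_eq_coe.1 h)

theorem MvPowerSeries.prod_map_X {σ R : Type*} [DecidableEq σ] [CommSemiring R] (l : List σ) :
    (l.map (X : σ → MvPowerSeries σ R)).prod =
      monomial (Multiset.toFinsupp (l : Multiset σ)) 1 := by
  induction l with
  | nil => simp
  | cons x l ih =>
    rw [List.map_cons, List.prod_cons, ih, X, monomial_mul_monomial, ← Multiset.cons_coe,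
      ← Multiset.singleton_add, map_add, Multiset.toFinsupp_singleton, one_mul]

theorem MvPowerSeries.prod_monomial_one {ι σ R : Type*} [CommSemiring R] (s : Finset ι)
    (d : ι → σ →₀ ℕ) :
    ∏ i ∈ s, monomial (d i) (1 : R) = monomial (∑ i ∈ s, d i) 1 := by
  classical
  induction s using Finset.induction_on with
  | empty => simp
  | insert i s hi ih =>
    rw [Finset.prod_insert hi, Finset.sum_insert hi, ih, monomial_mul_monomial, one_mul]

/-- A family of power series multiples of monomials is summable if only finitely many of the
monomials divide any given one. -/
theorem MvPowerSeries.summable_monomial_mul {ι σ R : Type*} [CommSemiring R] [TopologicalSpace R]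
    (d : ι → σ →₀ ℕ) (f : ι → MvPowerSeries σ R) (h : ∀ m, {i | d i ≤ m}.Finite) :
    Summable fun i => monomial (d i) 1 * f i := by
  classical
  refine MvPowerSeries.WithPiTopology.summable_iff_summable_coeff.2 fun m => ?_
  refine summable_of_hasFiniteSupport ((h m).subset fun i hi => ?_)
  by_contra hlt
  refine hi (show coeff m (monomial (d i) 1 * f i) = 0 from ?_)
  rw [coeff_monomial_mul]
  exact if_neg hlt

/-- Finite products of absolutely summable families of real numbers are summable. -/
theorem summable_pi_prod_of_nonneg {ι : Type*} [Fintype ι] {α : ι → Type*} {f : ∀ i, α i → ℝ}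
    (h0 : ∀ i x, 0 ≤ f i x) (hf : ∀ i, Summable (f i)) :
    Summable fun x : ∀ i, α i => ∏ i, f i (x i) := by
  classical
  refine summable_of_sum_le (c := ∏ i, ∑' x, f i x)
    (fun x => Finset.prod_nonneg fun i _ => h0 i _) fun u => ?_
  calc ∑ x ∈ u, ∏ i, f i (x i)
      ≤ ∑ x ∈ Fintype.piFinset fun i => u.image fun x => x i, ∏ i, f i (x i) :=
        Finset.sum_le_sum_of_subset_of_nonneg
          (fun x hx => Fintype.mem_piFinset.2 fun i => Finset.mem_image_of_mem _ hx)
          fun x _ _ => Finset.prod_nonneg fun i _ => h0 i _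
    _ = ∏ i, ∑ x ∈ u.image fun x => x i, f i x := (Finset.prod_univ_sum _ _).symm
    _ ≤ ∏ i, ∑' x, f i x := Finset.prod_le_prod
        (fun i _ => Finset.sum_nonneg fun x _ => h0 i x)
        fun i _ => (hf i).sum_le_tsum _ fun x _ => h0 i x

section

variable {V : Type*} [Quiver V] {bd : Set V} {k : ℕ} {a b : Fin k → V}

theorem InteriorWalk.weight_X [DecidableEq (Total V)] {R : Type*} [CommSemiring R] {x y : V}
    (p : InteriorWalk bd x y) :
    p.weight (MvPowerSeries.X : Total V → MvPowerSeries (Total V) R) =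
      MvPowerSeries.monomial (Multiset.toFinsupp (p.1.edges : Multiset (Total V))) 1 := by
  rw [InteriorWalk.weight, Path.weight_eq_prod_map_edges, MvPowerSeries.prod_map_X]

theorem InteriorWalk.finite_setOf_toFinsupp_edges_le [DecidableEq (Total V)] (x : V)
    (d : Total V →₀ ℕ) :
    {p : Σ j, InteriorWalk bd x (b j) |
      Multiset.toFinsupp (p.2.1.edges : Multiset (Total V)) ≤ d}.Finite := by
  refine ((Set.finite_univ (α := Fin k)).prod (List.finite_setOf_toFinsupp_le d)).preimage
    (f := fun p : Σ j, InteriorWalk bd x (b j) => (p.1, p.2.1.edges)) ?_ |>.subset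
      fun p hp => ⟨trivial, hp⟩
  rintro ⟨j, p⟩ - ⟨j', q⟩ - h
  simp only [Prod.mk.injEq] at h
  obtain ⟨rfl, h⟩ := h
  have := Path.edges_injective p.1 q.1 h
  simp only [Sigma.mk.injEq, heq_eq_eq, true_and] at this
  rw [Subtype.ext this]

theorem InteriorWalk.summable_weight_X {R : Type*} [CommSemiring R] [TopologicalSpace R] (x y : V) :
    Summable fun p : InteriorWalk bd x y =>
      p.weight (MvPowerSeries.X : Total V → MvPowerSeries (Total V) R) := by
  classical
  refine (MvPowerSeries.summable_monomial_mul _ 1 fun m =>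
    ((finite_setOf_toFinsupp_edges_le (bd := bd) (b := fun _ : Fin 1 => y) x m).preimage
      (f := Sigma.mk 0) (sigma_mk_injective.injOn))).congr fun p => ?_
  rw [weight_X, Pi.one_apply, mul_one]

theorem WalkFamily.summable_signedWeight_X {R : Type*} [CommRing R] [TopologicalSpace R] :
    Summable fun π : WalkFamily bd a b =>
      π.signedWeight (MvPowerSeries.X : Total V → MvPowerSeries (Total V) R) := by
  classical
  simp only [signedWeight_eq, InteriorWalk.weight_X, MvPowerSeries.prod_monomial_one]
  refine MvPowerSeries.summable_monomial_mul _ _ fun m => ?_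
  refine (Set.Finite.pi' fun i => InteriorWalk.finite_setOf_toFinsupp_edges_le (a i) m).subset
    fun π hπ i => ?_
  rw [Set.mem_ofPred_eq] at hπ ⊢
  refine le_trans ?_ hπ
  exact Finset.single_le_sum
    (f := fun i => Multiset.toFinsupp ((π i).2.1.edges : Multiset (Total V))) (fun _ _ => zero_le)
    (Finset.mem_univ i)

theorem WalkFamily.summable_signedWeight_real (w : Total V → ℝ)
    (hw : ∀ i j, Summable fun p : InteriorWalk bd (a i) (b j) => p.weight w) :
    Summable fun π : WalkFamily bd a b => π.signedWeight w := by
  have hprod : Summable fun π : WalkFamily bd a b => ∏ i, |(π i).2.weight w| := by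
    refine summable_pi_prod_of_nonneg
      (f := fun i (p : Σ j, InteriorWalk bd (a i) (b j)) => |p.2.weight w|)
      (fun i p => abs_nonneg _) fun i => ?_
    exact (summable_sigma_of_nonneg fun p => abs_nonneg _).2
      ⟨fun j => (hw i j).abs, Summable.of_finite⟩
  -- The end-point determinant takes finitely many values, so the sum of their absolute values is a
  -- uniform bound.
  let ε : (Fin k → Fin k) → ℝ := fun g =>
    |(Matrix.of fun i => (Pi.single (g i) 1 : Fin k → ℝ)).det|
  refine Summable.of_norm_bounded (hprod.mul_right (∑ g, ε g)) fun π => ?_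
  rw [signedWeight_eq, norm_mul, Real.norm_eq_abs, Finset.abs_prod]
  refine mul_le_mul_of_nonneg_left ?_ (Finset.prod_nonneg fun i _ => abs_nonneg _)
  exact Finset.single_le_sum (f := ε) (fun g _ => abs_nonneg _)
    (Finset.mem_univ fun i => (π i).1)

theorem InteriorWalk.weight_nonneg {w : Total V → ℝ} (hw : ∀ e, 0 ≤ w e) {x y : V}
    (p : InteriorWalk bd x y) : 0 ≤ p.weight w := by
  rw [weight, Path.weight_eq_prod_map_edges]
  exact List.prod_nonneg (by simpa using fun e _ => hw e)

theorem hasSum_weight_loopErasedFamily_real (hb : ∀ j, b j ∈ bd)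
    (hcross : ∀ i i' j j' : Fin k, i < i' → j' < j →
      ∀ (p : InteriorWalk bd (a i) (b j)) (q : InteriorWalk bd (a i') (b j')),
        ∃ v, v ∉ bd ∧ v ∈ p.vertices ∧ v ∈ q.vertices)
    (w : Total V → ℝ)
    (hw : ∀ i j, Summable fun p : InteriorWalk bd (a i) (b j) => p.weight w) :
    HasSum (fun π : LoopErasedFamily bd a b => π.weight w) (hittingSubmatrix bd w a b).det :=
  hasSum_weight_loopErasedFamily (fun _ hx => self_eq_neg.1 hx) hb hcross w hw
    (WalkFamily.summable_signedWeight_real w hw)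

theorem hasSum_weight_loopErasedFamily_X (hb : ∀ j, b j ∈ bd)
    (hcross : ∀ i i' j j' : Fin k, i < i' → j' < j →
      ∀ (p : InteriorWalk bd (a i) (b j)) (q : InteriorWalk bd (a i') (b j')),
        ∃ v, v ∉ bd ∧ v ∈ p.vertices ∧ v ∈ q.vertices) :
    HasSum (fun π : LoopErasedFamily bd a b =>
        π.weight (MvPowerSeries.X : Total V → MvPowerSeries (Total V) ℤ))
      (hittingSubmatrix bd
        (MvPowerSeries.X : Total V → MvPowerSeries (Total V) ℤ) a b).det := by
  refine hasSum_weight_loopErasedFamily (fun x hx => ?_) hb hcross _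
    (fun i j => InteriorWalk.summable_weight_X _ _) WalkFamily.summable_signedWeight_X
  ext d
  have := congrArg (MvPowerSeries.coeff d) hx
  rw [map_neg] at this
  exact self_eq_neg.1 this

end

theorem mainTheorem4 {V : Type*} [Quiver V] (bd : Set V) {k : ℕ} (a b : Fin k → V)
    (hb : ∀ j, b j ∈ bd)
    (hcross : ∀ i i' j j' : Fin k, i < i' → j' < j →
      ∀ (p : InteriorWalk bd (a i) (b j)) (q : InteriorWalk bd (a i') (b j')),
        ∃ v, v ∉ bd ∧ v ∈ p.vertices ∧ v ∈ q.vertices) :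
    -- formal power series in the edge weights
    ((∀ i j, Summable fun p : InteriorWalk bd (a i) (b j) =>
        p.weight (MvPowerSeries.X : Quiver.Total V → MvPowerSeries (Quiver.Total V) ℤ)) ∧
      HasSum (fun π : LoopErasedFamily bd a b =>
          π.weight (MvPowerSeries.X : Quiver.Total V → MvPowerSeries (Quiver.Total V) ℤ))
        (hittingSubmatrix bd
          (MvPowerSeries.X : Quiver.Total V → MvPowerSeries (Quiver.Total V) ℤ) a b).det) ∧
    -- real edge weights for which the entries of the submatrix converge
    (∀ w : Quiver.Total V → ℝ,
      (∀ i j, Summable fun p : InteriorWalk bd (a i) (b j) => p.weight w) →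
        HasSum (fun π : LoopErasedFamily bd a b => π.weight w) (hittingSubmatrix bd w a b).det ∧
        ((∀ e, 0 ≤ w e) → IsTotallyNonnegative (hittingSubmatrix bd w a b))) := by
  refine ⟨⟨fun i j => InteriorWalk.summable_weight_X _ _,
    hasSum_weight_loopErasedFamily_X hb hcross⟩, fun w hw =>
    ⟨hasSum_weight_loopErasedFamily_real hb hcross w hw, fun hpos r f g => ?_⟩⟩
  -- A minor is again a hitting determinant: order embeddings preserve the crossing condition, so
  -- its expansion has nonnegative terms.
  have h := hasSum_weight_loopErasedFamily_real (bd := bd) (a := a ∘ f) (b := b ∘ g)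
    (fun j => hb _) (fun i i' j j' hi hj => hcross (f i) (f i') (g j) (g j')
      (f.lt_iff_lt.2 hi) (g.lt_iff_lt.2 hj)) w fun i j => hw _ _
  exact h.nonneg fun π => Finset.prod_nonneg fun i _ => InteriorWalk.weight_nonneg hpos _
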